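/- **Setting.** Let $m=2^\ell$ and $0<n<m$ be integers, and put $\kappa=n/m\in(0,1)$. Let $H\in\mathbb R^{m\times m}$ be the Hadamard–Walsh matrix $H_{ij}=(-1)^{\langle \boldsymbol i,\boldsymbol j\rangle}/\sqrt m$, where $\boldsymbol i,\boldsymbol j\in\{0,1\}^\ell$ are the binary representations of $i-1,j-1$ for $i,j\in[m]=\{1,\dots,m\}$. Let $S$ be a uniformly random subset of $[m]$ with $n$ elements, let $B$ be the diagonal matrix with $B_{ii}=1$ if $i\in S$ and $B_{ii}=0$ otherwise, and put $\overline B=B-\kappa I_m$ and $\Psi=H\overline BH^{\mathsf T}$ (the sub-sampled Hadamard model). For $i,j\in[m]$ let $i\oplus j\in[m]$ be the index for which $(i\oplus j)-1$ is the bitwise sum modulo 2 of $i-1$ and $j-1$. Let $\pi=\{\mathcal V_1,\dots,\mathcal V_{|\pi|}\}$ be a partition of $[k]$, with $\pi(i)$ the block containing $i$, and let $w\in\mathbb N_0^{k\times k}$ be a weight matrix; only the entries $w_{ij}$ with $i<j$ are used (equivalently, $w$ is symmetric with zero diagonal). Put $\|w\|=\sum_{i<j}w_{ij}$ and $$W_{st}(w,\pi)=\sum_{i<j,\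 \{\pi(i),\pi(j)\}=\{\mathcal V_s,\mathcal V_t\}}w_{ij}.$$ The matrix $w$ is *disassortative* with respect to $\pi$ if $w_{ij}=0$ whenever $i<j$ and $\pi(i)=\pi(j)$. A *labelling* of $\pi$ is a vector $a\in[m]^k$ such that $a_i=a_j\Leftrightarrow\pi(i)=\pi(j)$; $a_{\mathcal V_s}$ denotes its value on $\mathcal V_s$. For $w$ disassortative, a labelling $a$ is *conflict-free* for $(w,\pi)$ if there are no distinct pairs $(s_1,t_1)\ne(s_2,t_2)$ with $s_1<t_1$, $s_2<t_2$, $W_{s_1t_1}(w,\pi)\ge1$, $W_{s_2t_2}(w,\pi)\ge1$ and $a_{\mathcal V_{s_1}}\oplus a_{\mathcal V_{t_1}}=a_{\mathcal V_{s_2}}\oplus a_{\mathcal V_{t_2}}$. The *matrix moment* of a symmetric $m\times m$ matrix $M$ is $$\mathcal M(M;w,\pi,a)=\prod_{1\le i<j\le k}M_{a_i,a_j}^{w_{ij}}.$$ **Proposition.** 1. If $w$ is not disassortative with respect to $\pi$, then $\mathcal M(\sqrt m\,\Psi;w,\pi,a)=0$ for every labelling $a$ of $\pi$ and every realization of $S$.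 2. There are constants $K_1,K_2,K_3>0$ depending only on $\|w\|$ such that, if $w$ is disassortative with respect to $\pi$, then for all $m\ge K_3$ (and all $n$ as above) and every conflict-free labelling $a$ of $(w,\pi)$, $$\left|\mathbb E\,\mathcal M(\sqrt m\,\Psi;w,\pi,a)-\prod_{1\le s<t\le|\pi|}\mathbb E\!\left[Z_\kappa^{W_{st}(w,\pi)}\right]\right|\le\frac{K_1\log^{K_2}(m)}{m^{1/4}},\qquad Z_\kappa\sim\mathcal N(0,\kappa(1-\kappa)).$$ -/

import Mathlib

open scoped BigOperators

noncomputable section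

namespace SubsampledHadamard

/-! Indices in `[m]`, `m = 2 ^ ℓ`, and in `[k]` are shifted to start at `0`. -/

/-- `⟨i, j⟩`, the inner product of the vectors of the `ℓ` binary digits of `i` and `j`. -/
def bitInner (ℓ : ℕ) (i j : Fin (2 ^ ℓ)) : ℕ :=
  ∑ r ∈ Finset.range ℓ, (i.val.testBit r).toNat * (j.val.testBit r).toNat

/-- The Hadamard-Walsh matrix of size `m = 2 ^ ℓ`, with entries `(-1) ^ ⟨i, j⟩ / √m`. -/
def hadamard (ℓ : ℕ) : Matrix (Fin (2 ^ ℓ)) (Fin (2 ^ ℓ)) ℝ :=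
  Matrix.of fun i j => (-1 : ℝ) ^ bitInner ℓ i j / √((2 : ℝ) ^ ℓ)

/-- The sampling ratio `κ = n / m`. -/
def kappa (ℓ n : ℕ) : ℝ := (n : ℝ) / (2 : ℝ) ^ ℓ

/-- The diagonal 0-1 matrix `B` which marks the sampled set `S`. -/
def sampleMatrix (ℓ : ℕ) (S : Finset (Fin (2 ^ ℓ))) : Matrix (Fin (2 ^ ℓ)) (Fin (2 ^ ℓ)) ℝ :=
  Matrix.diagonal fun i => if i ∈ S then 1 else 0

/-- `B̄ = B - κ I`. -/
def centeredSample (ℓ n : ℕ) (S : Finset (Fin (2 ^ ℓ))) :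
    Matrix (Fin (2 ^ ℓ)) (Fin (2 ^ ℓ)) ℝ :=
  sampleMatrix ℓ S - kappa ℓ n • (1 : Matrix (Fin (2 ^ ℓ)) (Fin (2 ^ ℓ)) ℝ)

/-- `Ψ = H B̄ Hᵀ`, for the sampled set `S`. -/
def Psi (ℓ n : ℕ) (S : Finset (Fin (2 ^ ℓ))) : Matrix (Fin (2 ^ ℓ)) (Fin (2 ^ ℓ)) ℝ :=
  hadamard ℓ * centeredSample ℓ n S * (hadamard ℓ).transpose

/-- The possible values of the random set `S`: all subsets of `[m]` with `n` elements. -/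
def samples (ℓ n : ℕ) : Finset (Finset (Fin (2 ^ ℓ))) :=
  Finset.powersetCard n Finset.univ

/-- The expectation of `f S`, where `S` is uniformly distributed on the subsets of `[m]` with
`n` elements. -/
def expectation (ℓ n : ℕ) (f : Finset (Fin (2 ^ ℓ)) → ℝ) : ℝ :=
  Finset.expect (samples ℓ n) f

/-- A partition `π` of `[k]`; the block of `i` is `π.part i`. -/
abbrev Part (k : ℕ) : Type := Finpartition (Finset.univ : Finset (Fin k))

variable {k : ℕ}

/-- The number `|π|` of blocks. -/
def numBlocks (π : Part k) : ℕ := π.parts.card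

/-- The blocks `V_s`, `s ∈ [|π|]`, in an arbitrary but fixed enumeration. -/
def block (π : Part k) (s : Fin (numBlocks π)) : Finset (Fin k) :=
  (π.parts.equivFin.symm s).1

theorem block_nonempty (π : Part k) (s : Fin (numBlocks π)) : (block π s).Nonempty :=
  π.nonempty_of_mem_parts (π.parts.equivFin.symm s).2

/-- The weight matrix has total weight `‖w‖ = ∑_{i<j} w_ij`. -/
def totalWeight (w : Matrix (Fin k) (Fin k) ℕ) : ℕ :=
  ∑ p : Fin k × Fin k with p.1 < p.2, w p.1 p.2

/-- `W_st(w, π)`, the total weight of the edges between the blocks `V_s` and `V_t`. -/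
def blockWeight (w : Matrix (Fin k) (Fin k) ℕ) (π : Part k) (s t : Fin (numBlocks π)) : ℕ :=
  ∑ p : Fin k × Fin k with p.1 < p.2 ∧
    ({π.part p.1, π.part p.2} : Finset (Finset (Fin k))) = {block π s, block π t},
    w p.1 p.2

/-- The `(w, π, a)`-matrix moment `∏_{i<j} M_{a_i, a_j} ^ w_ij`. It depends on `π` only through
the requirement on `a`. -/
def matMoment {ι : Type*} (M : Matrix ι ι ℝ) (w : Matrix (Fin k) (Fin k) ℕ) (a : Fin k → ι) : ℝ :=
  ∏ p : Fin k × Fin k with p.1 < p.2, M (a p.1) (a p.2) ^ w p.1 p.2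

/-- `w` is disassortative with respect to `π`. -/
def Disassortative (w : Matrix (Fin k) (Fin k) ℕ) (π : Part k) : Prop :=
  ∀ i j : Fin k, i < j → π.part i = π.part j → w i j = 0

/-- The labellings which are constant exactly on the blocks of `π`. -/
def IsLabelling {ι : Type*} (π : Part k) (a : Fin k → ι) : Prop :=
  ∀ i j : Fin k, a i = a j ↔ π.part i = π.part j

/-- `a_{V_s}`, the value of `a` on the block `V_s`. -/
def blockLabel {ι : Type*} (π : Part k) (a : Fin k → ι) (s : Fin (numBlocks π)) : ι :=
  a ((block π s).min' (block_nonempty π s))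

/-- `a` has a conflict between the pairs of blocks `(s₁, t₁)` and `(s₂, t₂)`. The operation
`⊕` is the bitwise exclusive or of the binary representations. -/
def HasConflict {ℓ : ℕ} (w : Matrix (Fin k) (Fin k) ℕ) (π : Part k) (a : Fin k → Fin (2 ^ ℓ))
    (s₁ t₁ s₂ t₂ : Fin (numBlocks π)) : Prop :=
  1 ≤ blockWeight w π s₁ t₁ ∧ 1 ≤ blockWeight w π s₂ t₂ ∧
    (blockLabel π a s₁).val ^^^ (blockLabel π a t₁).val =
      (blockLabel π a s₂).val ^^^ (blockLabel π a t₂).val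

/-- `a` is a conflict-free labelling of `(w, π)`. -/
def ConflictFree {ℓ : ℕ} (w : Matrix (Fin k) (Fin k) ℕ) (π : Part k)
    (a : Fin k → Fin (2 ^ ℓ)) : Prop :=
  IsLabelling π a ∧
    ∀ s₁ t₁ s₂ t₂ : Fin (numBlocks π), s₁ < t₁ → s₂ < t₂ → (s₁, t₁) ≠ (s₂, t₂) →
      ¬ HasConflict w π a s₁ t₁ s₂ t₂

/-- `E Z ^ q` for `Z ∼ N(0, κ (1 - κ))`. -/
def gaussianMoment (κ : ℝ) (q : ℕ) : ℝ :=
  ∫ x, x ^ q ∂(ProbabilityTheory.gaussianReal 0 (κ * (1 - κ)).toNNReal)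

/-- `∏_{s<t} E Z_κ ^ W_st(w, π)`. -/
def gaussianProduct (κ : ℝ) (w : Matrix (Fin k) (Fin k) ℕ) (π : Part k) : ℝ :=
  ∏ q : Fin (numBlocks π) × Fin (numBlocks π) with q.1 < q.2,
    gaussianMoment κ (blockWeight w π q.1 q.2)

end SubsampledHadamard

end

/-! Up to the factor `1/√m`, an off-diagonal entry of `√m Ψ` is the sum over `S` of a product of two
Walsh functions, a balanced sign function; the diagonal vanishes because `|S| = κ m`.
Disassortativity therefore turns the matrix moment into a monomial in normalized sums
(`matMoment_eq_monomial`), and absence of conflicts makes the sign functions of distinct block pairs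
orthogonal (`sum_walshPair_mul`).

Such monomials are compared with Gaussian moments by Stein's method for the random transposition
walk. A mean-zero normalized sum is an eigenfunction of its generator, so `E[normSum f * G]` equals
the mean of the carré du champ of `normSum f` and `G` (`samplingMean_normSum_mul`). On normalized
sums the carré du champ is nearly deterministic: `κ(1-κ)` on the diagonal and `0` for orthogonal
pairs, up to `O(m^{-1/2})` times sums with bounded moments. Mixed moments thus satisfy the Gaussian
recursion `E Z^(p+2) = (p+1) κ(1-κ) E Z^p` up to `O(m^{-1/2})`, and induction on the degree gives
`abs_samplingMean_monomial_sub_le`. The resulting rate is better than the one required. -/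

namespace SubsampledHadamard

set_option linter.unusedSectionVars false

/-! ### Exchanges of two points, integration by parts and the carré du champ -/

section Sampling

variable {X : Type} [Fintype X] [DecidableEq X]

/-- The mean of `F` over the `n`-element subsets of `X`. -/
noncomputable def samplingMean (n : ℕ) (F : Finset X → ℝ) : ℝ :=
  Finset.expect (Finset.powersetCard n Finset.univ) F

theorem samplingMean_add (n : ℕ) (F G : Finset X → ℝ) :
    samplingMean n (fun S => F S + G S) = samplingMean n F + samplingMean n G :=
  Finset.expect_add_distrib _ _ _

theorem samplingMean_sub (n : ℕ) (F G : Finset X → ℝ) :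
    samplingMean n (fun S => F S - G S) = samplingMean n F - samplingMean n G :=
  Finset.expect_sub_distrib _ _ _

theorem samplingMean_const_mul (n : ℕ) (c : ℝ) (F : Finset X → ℝ) :
    samplingMean n (fun S => c * F S) = c * samplingMean n F :=
  (Finset.mul_expect _ _ _).symm

theorem samplingMean_sum {α : Type*} (n : ℕ) (s : Finset α) (F : α → Finset X → ℝ) :
    samplingMean n (fun S => ∑ i ∈ s, F i S) = ∑ i ∈ s, samplingMean n (F i) :=
  Finset.expect_sum_comm _ _ _

theorem samplingMean_mono {n : ℕ} {F G : Finset X → ℝ} (h : ∀ S, S.card = n → F S ≤ G S) :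
    samplingMean n F ≤ samplingMean n G :=
  Finset.expect_le_expect fun S hS => h S (Finset.mem_powersetCard.1 hS).2

theorem samplingMean_congr {n : ℕ} {F G : Finset X → ℝ} (h : ∀ S, S.card = n → F S = G S) :
    samplingMean n F = samplingMean n G :=
  Finset.expect_congr rfl fun S hS => h S (Finset.mem_powersetCard.1 hS).2

theorem abs_samplingMean_le (n : ℕ) (F : Finset X → ℝ) :
    |samplingMean n F| ≤ samplingMean n fun S => |F S| :=
  Finset.abs_expect_le _ _

theorem samplingMean_const {n : ℕ} (hn : n ≤ Fintype.card X) (c : ℝ) :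
    samplingMean n (fun _ : Finset X => c) = c :=
  Finset.expect_const (Finset.powersetCard_nonempty.2 (by simpa using hn)) c

/-- For `n` beyond the size of `X` the mean runs over an empty family and is `0`; an inequality for
nonnegative constants survives this, so the moment bounds below need no condition on `n`. -/
theorem samplingMean_const_le (n : ℕ) {c : ℝ} (hc : 0 ≤ c) :
    samplingMean n (fun _ : Finset X => c) ≤ c := by
  rcases (Finset.powersetCard n (Finset.univ : Finset X)).eq_empty_or_nonempty with h | h
  · simpa [samplingMean, h] using hc
  · exact (Finset.expect_const h c).le

/-- The set `S` with the points `x` and `y` exchanged. -/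
def swapSet (x y : X) (S : Finset X) : Finset X :=
  S.map (Equiv.swap x y).toEmbedding

theorem card_swapSet (x y : X) (S : Finset X) : (swapSet x y S).card = S.card :=
  Finset.card_map _

theorem swapSet_swapSet (x y : X) (S : Finset X) : swapSet x y (swapSet x y S) = S := by
  ext z
  simp [swapSet, Finset.mem_map_equiv]

theorem samplingMean_swapSet (n : ℕ) (x y : X) (F : Finset X → ℝ) :
    samplingMean n (fun S => F (swapSet x y S)) = samplingMean n F := by
  refine Finset.expect_nbij' (swapSet x y) (swapSet x y) ?_ ?_ ?_ ?_ ?_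
  · intro S hS
    simpa [Finset.mem_powersetCard, card_swapSet] using hS
  · intro S hS
    simpa [Finset.mem_powersetCard, card_swapSet] using hS
  · exact fun S _ => swapSet_swapSet x y S
  · exact fun S _ => swapSet_swapSet x y S
  · exact fun S _ => rfl

/-- The change of `F` when `x` and `y` are exchanged. -/
def swapDiff (x y : X) (F : Finset X → ℝ) (S : Finset X) : ℝ :=
  F (swapSet x y S) - F S

theorem swapDiff_mul (x y : X) (F G : Finset X → ℝ) (S : Finset X) :
    swapDiff x y (fun S => F S * G S) S =
      swapDiff x y F S * G S + F S * swapDiff x y G S + swapDiff x y F S * swapDiff x y G S := by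
  simp only [swapDiff]; ring

/-- Summation by parts for one exchange. -/
theorem samplingMean_swapDiff_mul (n : ℕ) (x y : X) (F G : Finset X → ℝ) :
    samplingMean n (fun S => swapDiff x y F S * swapDiff x y G S) =
      -2 * samplingMean n (fun S => swapDiff x y F S * G S) := by
  have h := samplingMean_swapSet n x y fun S => F S * G S
  have h' := samplingMean_swapSet n x y fun S => F (swapSet x y S) * G S
  simp only [swapSet_swapSet] at h'
  simp only [swapDiff, sub_mul, mul_sub, samplingMean_sub] at *
  linarith

/-- The carré du champ of the random transposition walk. -/
noncomputable def carreDuChamp (F G : Finset X → ℝ) (S : Finset X) : ℝ :=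
  (∑ x, ∑ y, swapDiff x y F S * swapDiff x y G S) / (4 * Fintype.card X)

/-- The normalized sum of `f` over `S`. -/
noncomputable def normSum (f : X → ℝ) (S : Finset X) : ℝ :=
  (∑ x ∈ S, f x) / √(Fintype.card X)

/-- The indicator of `S`. -/
noncomputable def ind (S : Finset X) (x : X) : ℝ := if x ∈ S then 1 else 0

theorem ind_mul_self (S : Finset X) (x : X) : ind S x * ind S x = ind S x := by
  by_cases h : x ∈ S <;> simp [ind, h]

theorem sum_ind_mul (S : Finset X) (f : X → ℝ) : ∑ x, ind S x * f x = ∑ x ∈ S, f x := by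
  simp [ind, Finset.sum_ite_mem]

theorem sum_ind (S : Finset X) : ∑ x, ind S x = S.card := by
  simp [ind, Finset.sum_ite_mem]

/-- An exchange acts only if exactly one of `x`, `y` lies in `S`; that point is then replaced by the
other. -/
theorem swapDiff_normSum (f : X → ℝ) (x y : X) (S : Finset X) :
    swapDiff x y (normSum f) S =
      (ind S y - ind S x) * (f x - f y) / √(Fintype.card X) := by
  have h : ∀ z, f (Equiv.swap x y z) - f z =
      (if z = x then f y - f x else 0) + (if z = y then f x - f y else 0) := by
    intro z
    by_cases hx : z = x
    · subst hx
      by_cases hy : z = y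
      · subst hy; simp
      · simp [hy]
    · by_cases hy : z = y
      · subst hy; simp [hx]
      · simp [hx, hy, Equiv.swap_apply_of_ne_of_ne hx hy]
  rw [swapDiff, normSum, normSum, swapSet, Finset.sum_map, ← sub_div, ← Finset.sum_sub_distrib]
  congr 1
  simp only [Equiv.coe_toEmbedding, h, Finset.sum_add_distrib, Finset.sum_ite_eq', ind]
  split_ifs <;> ring

/-- The functions with values `±1` which sum to zero. -/
structure BalancedSign (f : X → ℝ) : Prop where
  sq : ∀ x, f x * f x = 1
  sum : ∑ x, f x = 0

theorem BalancedSign.mul {f g : X → ℝ} (hf : BalancedSign f) (hg : BalancedSign g)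
    (h : ∑ x, f x * g x = 0) : BalancedSign fun x => f x * g x :=
  ⟨fun x => by rw [mul_mul_mul_comm, hf.sq, hg.sq, one_mul], h⟩

theorem BalancedSign.abs {f : X → ℝ} (hf : BalancedSign f) (x : X) : |f x| = 1 := by
  have h := hf.sq x
  rw [← abs_mul_abs_self] at h
  nlinarith [abs_nonneg (f x)]

theorem abs_swapDiff_normSum_le {f : X → ℝ} (hf : BalancedSign f) (x y : X) (S : Finset X) :
    |swapDiff x y (normSum f) S| ≤ 2 / √(Fintype.card X) := by
  rw [swapDiff_normSum, abs_div, abs_of_nonneg (Real.sqrt_nonneg _), abs_mul]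
  gcongr
  have h₁ : |ind S y - ind S x| ≤ 1 := by
    unfold ind
    split_ifs <;> norm_num
  have h₂ : |f x - f y| ≤ 2 := by
    refine (abs_sub _ _).trans ?_
    rw [hf.abs, hf.abs]; norm_num
  nlinarith [abs_nonneg (ind S y - ind S x), abs_nonneg (f x - f y)]

/-- This is the eigenfunction property behind integration by parts: summing over one point of the
exchange averages `f` to zero and leaves a multiple of the sum itself. -/
theorem sum_swapDiff_normSum {f : X → ℝ} (hf : ∑ x, f x = 0) (S : Finset X) :
    ∑ x, ∑ y, swapDiff x y (normSum f) S = -2 * Fintype.card X * normSum f S := by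
  have h : ∀ x y, (ind S y - ind S x) * (f x - f y) =
      f x * ind S y - ind S y * f y - ind S x * f x + ind S x * f y := fun x y => by ring
  simp only [swapDiff_normSum, ← Finset.sum_div, h, Finset.sum_add_distrib,
    Finset.sum_sub_distrib, ← Finset.mul_sum, ← Finset.sum_mul, hf, sum_ind_mul,
    Finset.sum_const, Finset.card_univ, nsmul_eq_mul, normSum]
  ring

/-- Integration by parts for the sampling distribution. -/
theorem samplingMean_normSum_mul [Nonempty X] (n : ℕ) {f : X → ℝ} (hf : ∑ x, f x = 0)
    (G : Finset X → ℝ) :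
    samplingMean n (fun S => normSum f S * G S) = samplingMean n (carreDuChamp (normSum f) G) := by
  have hm : (0 : ℝ) < Fintype.card X := by exact_mod_cast Fintype.card_pos
  have h₁ : samplingMean n (carreDuChamp (normSum f) G) =
      (1 / (4 * Fintype.card X)) * ∑ x, ∑ y,
        samplingMean n (fun S => swapDiff x y (normSum f) S * swapDiff x y G S) := by
    simp only [← samplingMean_sum, ← samplingMean_const_mul]
    refine samplingMean_congr fun S _ => ?_
    rw [carreDuChamp]; ring
  simp only [h₁, samplingMean_swapDiff_mul, ← Finset.mul_sum]
  simp only [← samplingMean_sum, ← Finset.sum_mul, sum_swapDiff_normSum hf, mul_assoc,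
    samplingMean_const_mul]
  field_simp
  ring

/-- Idempotence of the indicator reduces the double sum to products of single sums, and those
containing a full sum of `f` or `g` vanish. -/
theorem carreDuChamp_normSum {f g : X → ℝ} (hf : ∑ x, f x = 0) (hg : ∑ x, g x = 0)
    (S : Finset X) :
    carreDuChamp (normSum f) (normSum g) S =
      (2 * (Fintype.card X - 2 * S.card) * (∑ x ∈ S, f x * g x) + 2 * S.card * (∑ x, f x * g x) +
        4 * (∑ x ∈ S, f x) * (∑ x ∈ S, g x)) / (4 * Fintype.card X * Fintype.card X) := by
  have hs : √(Fintype.card X : ℝ) * √(Fintype.card X) = Fintype.card X :=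
    Real.mul_self_sqrt (Nat.cast_nonneg _)
  have h : ∀ x y, (ind S y - ind S x) * (f x - f y) / √(Fintype.card X) *
        ((ind S y - ind S x) * (g x - g y) / √(Fintype.card X)) =
      ((ind S x * (f x * g x)) * 1 - (ind S x * f x) * g y - (ind S x * g x) * f y
        + ind S x * (f y * g y) + (f x * g x) * ind S y - f x * (ind S y * g y)
        - g x * (ind S y * f y) + 1 * (ind S y * (f y * g y)) - 2 * ((ind S x * (f x * g x)) * ind S y)
        + 2 * ((ind S x * f x) * (ind S y * g y)) + 2 * ((ind S x * g x) * (ind S y * f y))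
        - 2 * (ind S x * (ind S y * (f y * g y)))) / Fintype.card X := fun x y => by
    rw [div_mul_div_comm, hs]
    congr 1
    linear_combination (f x - f y) * (g x - g y) * (ind_mul_self S x + ind_mul_self S y)
  simp only [carreDuChamp, swapDiff_normSum, h, ← Finset.sum_div, Finset.sum_add_distrib,
    Finset.sum_sub_distrib, ← Finset.mul_sum, ← Finset.sum_mul, hf, hg, sum_ind_mul, sum_ind,
    Finset.sum_const, Finset.card_univ, nsmul_eq_mul]
  rw [div_div]
  congr 1 <;> ring

theorem sum_eq_sqrt_mul_normSum [Nonempty X] (f : X → ℝ) (S : Finset X) :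
    ∑ x ∈ S, f x = √(Fintype.card X) * normSum f S := by
  have : (0 : ℝ) < √(Fintype.card X) := Real.sqrt_pos.2 (by exact_mod_cast Fintype.card_pos)
  rw [normSum]; field_simp

theorem one_le_sqrt_card [Nonempty X] : 1 ≤ √(Fintype.card X : ℝ) :=
  Real.one_le_sqrt.2 (by exact_mod_cast Fintype.card_pos)

/-- The difference is exactly `normSum f S ^ 2 / m`; the weaker denominator `√m` matches the
orthogonal case. -/
theorem carreDuChamp_normSum_self [Nonempty X] {f : X → ℝ} (hf : BalancedSign f)
    (S : Finset X) :
    |carreDuChamp (normSum f) (normSum f) S -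
        (S.card / Fintype.card X : ℝ) * (1 - S.card / Fintype.card X)| ≤
      (|normSum f S| * |normSum f S|) / √(Fintype.card X) := by
  have hr := one_le_sqrt_card (X := X)
  have hs : (Fintype.card X : ℝ) = √(Fintype.card X) * √(Fintype.card X) :=
    (Real.mul_self_sqrt (Nat.cast_nonneg _)).symm
  rw [carreDuChamp_normSum hf.sum hf.sum, sum_eq_sqrt_mul_normSum f S]
  simp only [hf.sq, Finset.sum_const, Finset.card_univ, nsmul_eq_mul, mul_one]
  set r := √(Fintype.card X : ℝ)
  rw [hs]
  have : (2 * (r * r - 2 * S.card) * S.card + 2 * S.card * (r * r) +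
      4 * (r * normSum f S) * (r * normSum f S)) / (4 * (r * r) * (r * r)) -
      (S.card / (r * r) : ℝ) * (1 - S.card / (r * r)) =
      normSum f S * normSum f S / (r * r) := by
    have : r ≠ 0 := by positivity
    field_simp; ring
  rw [this, abs_div, abs_mul, abs_of_nonneg (by positivity : 0 ≤ r * r)]
  gcongr
  nlinarith

/-- The leading term is `(m - 2|S|) / (2m)` times `normSum (f g) / √m`. Orthogonality makes `f g`
balanced, so this sum has bounded moments too; this term is of order `m^{-1/2}`. -/
theorem carreDuChamp_normSum_of_orthogonal [Nonempty X] {f g : X → ℝ} (hf : BalancedSign f)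
    (hg : BalancedSign g) (h : ∑ x, f x * g x = 0) (S : Finset X) :
    |carreDuChamp (normSum f) (normSum g) S| ≤
      (|normSum (fun x => f x * g x) S| + |normSum f S| * |normSum g S|) /
        √(Fintype.card X) := by
  have hr := one_le_sqrt_card (X := X)
  have hs : (Fintype.card X : ℝ) = √(Fintype.card X) * √(Fintype.card X) :=
    (Real.mul_self_sqrt (Nat.cast_nonneg _)).symm
  have hc : (S.card : ℝ) ≤ Fintype.card X := by exact_mod_cast S.card_le_univ
  rw [carreDuChamp_normSum hf.sum hg.sum, sum_eq_sqrt_mul_normSum f S,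
    sum_eq_sqrt_mul_normSum g S, sum_eq_sqrt_mul_normSum (fun x => f x * g x) S, h]
  set r := √(Fintype.card X : ℝ)
  rw [hs] at hc ⊢
  have hr0 : r ≠ 0 := by positivity
  have : (2 * (r * r - 2 * S.card) * (r * normSum (fun x => f x * g x) S) + 2 * S.card * 0 +
      4 * (r * normSum f S) * (r * normSum g S)) / (4 * (r * r) * (r * r)) =
      ((r * r - 2 * S.card) / (2 * (r * r)) * normSum (fun x => f x * g x) S +
        normSum f S * normSum g S / r) / r := by
    field_simp; ring
  rw [this, abs_div, abs_of_pos (by positivity : 0 < r)]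
  gcongr
  refine (abs_add_le _ _).trans (add_le_add ?_ ?_)
  · rw [abs_mul]
    refine mul_le_of_le_one_left (abs_nonneg _) ?_
    rw [abs_div, abs_of_pos (by positivity : 0 < 2 * (r * r)), div_le_one (by positivity), abs_le]
    have : (0 : ℝ) ≤ S.card := Nat.cast_nonneg _
    constructor <;> nlinarith
  · rw [abs_div, abs_mul, abs_of_pos (by positivity : 0 < r)]
    exact div_le_self (by positivity) hr

end Sampling

end SubsampledHadamard

namespace SubsampledHadamard

set_option linter.unusedSectionVars false

/-! ### Moment bounds uniform in the ground set -/

section Moments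

variable {X : Type} [Fintype X] [DecidableEq X]

/-- The product of the normalized sums of the members of `M`. -/
noncomputable def monomial (M : Multiset (X → ℝ)) (S : Finset X) : ℝ :=
  (M.map fun f => normSum f S).prod

/-- An upper bound, at least one, for all sub-products of `monomial M`. -/
noncomputable def envelope (M : Multiset (X → ℝ)) (S : Finset X) : ℝ :=
  (M.map fun f => 1 + |normSum f S|).prod

@[simp] theorem monomial_zero : monomial (0 : Multiset (X → ℝ)) = fun _ => 1 := by
  funext S; simp [monomial]

@[simp] theorem monomial_cons (f : X → ℝ) (M : Multiset (X → ℝ)) :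
    monomial (f ::ₘ M) = fun S => normSum f S * monomial M S := by
  funext S; simp [monomial]

@[simp] theorem envelope_zero (S : Finset X) : envelope (0 : Multiset (X → ℝ)) S = 1 := by
  simp [envelope]

@[simp] theorem envelope_cons (f : X → ℝ) (M : Multiset (X → ℝ)) (S : Finset X) :
    envelope (f ::ₘ M) S = (1 + |normSum f S|) * envelope M S := by
  simp [envelope]

@[simp] theorem envelope_add (M N : Multiset (X → ℝ)) (S : Finset X) :
    envelope (M + N) S = envelope M S * envelope N S := by
  simp [envelope]

theorem one_le_envelope (M : Multiset (X → ℝ)) (S : Finset X) : 1 ≤ envelope M S := by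
  induction M using Multiset.induction with
  | empty => simp
  | cons f M ih =>
    rw [envelope_cons]
    nlinarith [abs_nonneg (normSum f S)]

theorem envelope_nonneg (M : Multiset (X → ℝ)) (S : Finset X) : 0 ≤ envelope M S :=
  zero_le_one.trans (one_le_envelope M S)

theorem abs_monomial_le (M : Multiset (X → ℝ)) (S : Finset X) :
    |monomial M S| ≤ envelope M S := by
  induction M using Multiset.induction with
  | empty => simp
  | cons f M ih =>
    rw [envelope_cons, monomial_cons, abs_mul]
    gcongr
    linarith

theorem two_div_sqrt_card_le [Nonempty X] : 2 / √(Fintype.card X : ℝ) ≤ 2 :=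
  div_le_self (by norm_num) one_le_sqrt_card

/-- By the discrete product rule a new factor `f` multiplies the bound by at most `1 + |normSum f S|
+ 2`, the `2` coming from the product of increments, and this is at most `3 (1 + |normSum f S|)`. -/
theorem abs_swapDiff_monomial_le [Nonempty X] {M : Multiset (X → ℝ)}
    (hM : ∀ f ∈ M, BalancedSign f) (x y : X) (S : Finset X) :
    |swapDiff x y (monomial M) S| ≤
      2 / √(Fintype.card X) * (3 ^ Multiset.card M * envelope M S) := by
  induction M using Multiset.induction with
  | empty =>
    simp only [monomial_zero, swapDiff, sub_self, abs_zero, envelope_zero]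
    positivity
  | cons f M ih =>
    have h := ih fun g hg => hM g (Multiset.mem_cons_of_mem hg)
    have hf := abs_swapDiff_normSum_le (hM f (Multiset.mem_cons_self f M)) x y S
    have hδ := two_div_sqrt_card_le (X := X)
    have hδ0 : 0 ≤ 2 / √(Fintype.card X : ℝ) := by positivity
    rw [monomial_cons, swapDiff_mul, envelope_cons, Multiset.card_cons, pow_succ]
    set δ := 2 / √(Fintype.card X : ℝ)
    have hE := envelope_nonneg M S
    have h3 : (1 : ℝ) ≤ 3 ^ Multiset.card M := one_le_pow₀ (by norm_num)
    calc _ ≤ |swapDiff x y (normSum f) S| * |monomial M S| +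
          |normSum f S| * |swapDiff x y (monomial M) S| +
          |swapDiff x y (normSum f) S| * |swapDiff x y (monomial M) S| := by
            simp only [← abs_mul]
            exact (abs_add_le _ _).trans (add_le_add_left (abs_add_le _ _) _)
      _ ≤ δ * (3 ^ Multiset.card M * envelope M S) +
          |normSum f S| * (δ * (3 ^ Multiset.card M * envelope M S)) +
          2 * (δ * (3 ^ Multiset.card M * envelope M S)) := by
            gcongr
            · exact (abs_monomial_le M S).trans (le_mul_of_one_le_left hE h3)
            · exact hf.trans hδ
      _ ≤ _ := by
            have : 0 ≤ δ * (3 ^ Multiset.card M * envelope M S) := by positivity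
            nlinarith [abs_nonneg (normSum f S)]

/-- Each of the `m ^ 2` pairs contributes at most `4 B / m`, which the normalization `4 m` cancels
exactly. -/
theorem abs_sum_sum_mul_div_le [Nonempty X] {u v : X → X → ℝ} {B : ℝ}
    (hu : ∀ x y, |u x y| ≤ 2 / √(Fintype.card X))
    (hv : ∀ x y, |v x y| ≤ 2 / √(Fintype.card X) * B) :
    |(∑ x, ∑ y, u x y * v x y) / (4 * Fintype.card X)| ≤ B := by
  have hm : (0 : ℝ) < Fintype.card X := by exact_mod_cast Fintype.card_pos
  have hs : √(Fintype.card X : ℝ) * √(Fintype.card X) = Fintype.card X :=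
    Real.mul_self_sqrt (Nat.cast_nonneg _)
  rw [abs_div, abs_of_pos (by positivity : (0 : ℝ) < 4 * Fintype.card X),
    div_le_iff₀ (by positivity)]
  calc _ ≤ ∑ x : X, ∑ y : X, |u x y * v x y| :=
        (Finset.abs_sum_le_sum_abs _ _).trans
          (Finset.sum_le_sum fun x _ => Finset.abs_sum_le_sum_abs _ _)
    _ ≤ ∑ x : X, ∑ y : X, 4 / Fintype.card X * B := by
        refine Finset.sum_le_sum fun x _ => Finset.sum_le_sum fun y _ => ?_
        rw [abs_mul]
        calc _ ≤ 2 / √(Fintype.card X : ℝ) * (2 / √(Fintype.card X) * B) :=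
              mul_le_mul (hu x y) (hv x y) (abs_nonneg _) (by positivity)
          _ = _ := by
              rw [← mul_assoc, div_mul_div_comm, hs]; norm_num
    _ = _ := by
        simp only [Finset.sum_const, Finset.card_univ, nsmul_eq_mul]
        field_simp

theorem abs_swapDiff_normSum_pow_le [Nonempty X] {f : X → ℝ} (hf : BalancedSign f) (p : ℕ)
    (x y : X) (S : Finset X) :
    |swapDiff x y (fun S => normSum f S ^ (p + 1)) S| ≤
      2 / √(Fintype.card X) * ((p + 1) * 2 ^ p * (1 + |normSum f S|) ^ p) := by
  have h := abs_swapDiff_normSum_le hf x y S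
  have hδ := two_div_sqrt_card_le (X := X)
  simp only [swapDiff] at h ⊢
  refine (abs_pow_sub_pow_le _ _ _).trans ?_
  have hmax : max |normSum f (swapSet x y S)| |normSum f S| ≤ 2 * (1 + |normSum f S|) := by
    refine max_le ?_ (by linarith [abs_nonneg (normSum f S)])
    have := abs_sub_abs_le_abs_sub (normSum f (swapSet x y S)) (normSum f S)
    linarith [abs_nonneg (normSum f S)]
  rw [Nat.add_sub_cancel, mul_assoc, mul_assoc, ← mul_pow]
  push_cast
  gcongr

/-- Integration by parts bounds the moment of order `2p + 2` by the carré du champ of the sum and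
its power `2p + 1`, hence by a multiple of the shifted moment of order `2p`. -/
theorem samplingMean_normSum_pow_le (p : ℕ) : ∃ C : ℝ, 0 ≤ C ∧
    ∀ (X : Type) [Fintype X] [DecidableEq X] [Nonempty X] (n : ℕ) (f : X → ℝ), BalancedSign f →
      samplingMean n (fun S => (1 + |normSum f S|) ^ (2 * p)) ≤ C := by
  induction p with
  | zero => exact ⟨1, zero_le_one, fun X _ _ _ n f _ => by
      simpa using samplingMean_const_le (X := X) n zero_le_one⟩
  | succ p ih =>
    obtain ⟨C, hC, h⟩ := ih
    set K : ℝ := ((2 * p : ℕ) + 1) * 2 ^ (2 * p)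
    refine ⟨2 ^ (2 * (p + 1)) * (1 + K * C), by positivity, fun X _ _ _ n f hf => ?_⟩
    have h₁ : samplingMean n (fun S => normSum f S ^ (2 * (p + 1))) ≤ K * C := by
      calc _ = samplingMean n (fun S => normSum f S * normSum f S ^ (2 * p + 1)) :=
            samplingMean_congr fun S _ => by ring
        _ = samplingMean n (carreDuChamp (normSum f) fun S => normSum f S ^ (2 * p + 1)) :=
            samplingMean_normSum_mul n hf.sum _
        _ ≤ samplingMean n fun S => K * (1 + |normSum f S|) ^ (2 * p) :=
            samplingMean_mono fun S _ => (le_abs_self _).trans <|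
              abs_sum_sum_mul_div_le
                (fun x y => abs_swapDiff_normSum_le hf x y S)
                fun x y => abs_swapDiff_normSum_pow_le hf (2 * p) x y S
        _ ≤ K * C := by
            rw [samplingMean_const_mul]
            exact mul_le_mul_of_nonneg_left (h X n f hf) (by positivity)
    calc _ ≤ samplingMean n
          (fun S : Finset X => 2 ^ (2 * (p + 1)) * (1 + normSum f S ^ (2 * (p + 1)))) :=
          samplingMean_mono fun S _ => by
            have := add_pow_le zero_le_one (abs_nonneg (normSum f S)) (2 * (p + 1))
            rw [one_pow, (even_two_mul (p + 1)).pow_abs] at this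
            refine this.trans ?_
            have : 0 ≤ normSum f S ^ (2 * (p + 1)) := (even_two_mul (p + 1)).pow_nonneg _
            gcongr
            · norm_num
            · omega
      _ ≤ _ := by
          rw [samplingMean_const_mul, samplingMean_add]
          gcongr
          exact samplingMean_const_le n zero_le_one

/-- The largest factor dominates the product, which replaces Hölder's inequality. The exponent is
doubled to be even, as in `samplingMean_normSum_pow_le`. -/
theorem multiset_prod_le_one_add_sum_pow (s : Multiset ℝ) (hs : ∀ a ∈ s, 1 ≤ a) :
    s.prod ≤ 1 + (s.map fun a => a ^ (2 * Multiset.card s)).sum := by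
  have h0 : ∀ b ∈ s.map (fun a => a ^ (2 * Multiset.card s)), (0 : ℝ) ≤ b := by
    intro b hb
    obtain ⟨a, ha, rfl⟩ := Multiset.mem_map.1 hb
    exact pow_nonneg (zero_le_one.trans (hs a ha)) _
  rcases eq_or_ne s 0 with rfl | hne
  · simp
  obtain ⟨a, ha, hmax⟩ := Multiset.exists_max_image (f := id) hne
  have h₁ : s.prod ≤ a ^ Multiset.card s := by
    have := Multiset.prod_map_le_pow_card (r := a) (f := RingHom.id ℝ) (t := s)
      (fun b hb => zero_le_one.trans (hs b hb)) (fun b hb => hmax b hb)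
    simpa using this
  have h₂ : a ^ Multiset.card s ≤ a ^ (2 * Multiset.card s) :=
    pow_le_pow_right₀ (hs a ha) (by omega)
  have h₃ := Multiset.single_le_sum h0 _ (Multiset.mem_map_of_mem _ ha)
  linarith

theorem samplingMean_multiset_sum_le {α : Type*} (n : ℕ) (M : Multiset α)
    (h : α → Finset X → ℝ) {C : ℝ} (hC : ∀ i ∈ M, samplingMean n (h i) ≤ C) :
    samplingMean n (fun S => (M.map fun i => h i S).sum) ≤ Multiset.card M * C := by
  induction M using Multiset.induction with
  | empty => simpa using samplingMean_const_le (X := X) n le_rfl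
  | cons i M ih =>
    simp only [Multiset.map_cons, Multiset.sum_cons, samplingMean_add, Multiset.card_cons]
    have h₁ := hC i (Multiset.mem_cons_self i M)
    have h₂ := ih fun j hj => hC j (Multiset.mem_cons_of_mem hj)
    push_cast
    linarith

theorem samplingMean_envelope_le (r : ℕ) : ∃ C : ℝ, 0 ≤ C ∧
    ∀ (X : Type) [Fintype X] [DecidableEq X] [Nonempty X] (n : ℕ) (M : Multiset (X → ℝ)),
      (∀ f ∈ M, BalancedSign f) → Multiset.card M = r → samplingMean n (envelope M) ≤ C := by
  obtain ⟨C, hC, h⟩ := samplingMean_normSum_pow_le r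
  refine ⟨1 + r * C, by positivity, fun X _ _ _ n M hM hr => ?_⟩
  calc _ ≤ samplingMean n
        (fun S => 1 + (M.map fun f => (1 + |normSum f S|) ^ (2 * r)).sum) :=
        samplingMean_mono fun S _ => by
          have := multiset_prod_le_one_add_sum_pow (M.map fun f => 1 + |normSum f S|) (by
            intro a ha
            obtain ⟨f, -, rfl⟩ := Multiset.mem_map.1 ha
            linarith [abs_nonneg (normSum f S)])
          simpa [envelope, Multiset.map_map, hr] using this
    _ ≤ _ := by
        rw [samplingMean_add]
        refine add_le_add (samplingMean_const_le n zero_le_one) ?_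
        rw [← hr]
        exact samplingMean_multiset_sum_le n M _ fun f hf => hr ▸ h X n f (hM f hf)

end Moments

end SubsampledHadamard

namespace SubsampledHadamard

set_option linter.unusedSectionVars false

/-! ### Stein error and comparison with the Gaussian recursion -/

section Comparison

variable {X : Type} [Fintype X] [DecidableEq X] {ι : Type} [DecidableEq ι]

/-- Multiplicity times the monomial with one `c` erased is the formal partial derivative in the
variable `c`; this is its Leibniz rule. -/
theorem count_mul_monomial_erase_cons (f : ι → X → ℝ) (c c' : ι) (M : Multiset ι)
    (S : Finset X) :
    ((c' ::ₘ M).count c : ℝ) * monomial (((c' ::ₘ M).erase c).map f) S =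
      (if c' = c then monomial (M.map f) S else 0) +
        normSum (f c') S * ((M.count c : ℝ) * monomial ((M.erase c).map f) S) := by
  by_cases h : c' = c
  · subst h
    simp only [Multiset.count_cons_self, Multiset.erase_cons_head, if_true]
    by_cases hc : c' ∈ M
    · obtain ⟨N, rfl⟩ := Multiset.exists_cons_of_mem hc
      simp only [Multiset.erase_cons_head, Multiset.map_cons, monomial_cons]
      push_cast
      ring
    · simp [Multiset.count_eq_zero_of_notMem hc]
  · rw [Multiset.count_cons_of_ne (Ne.symm h), Multiset.erase_cons_tail _ h, if_neg h,
      Multiset.map_cons, monomial_cons]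
    ring

/-- An exchange is not a derivation, so the Leibniz rule acquires a remainder with three increments.
-/
theorem carreDuChamp_cons (F : Finset X → ℝ) (g : X → ℝ) (M : Multiset (X → ℝ))
    (S : Finset X) :
    carreDuChamp F (monomial (g ::ₘ M)) S =
      carreDuChamp F (normSum g) S * monomial M S +
        normSum g S * carreDuChamp F (monomial M) S +
        (∑ x, ∑ y, swapDiff x y F S *
          (swapDiff x y (normSum g) S * swapDiff x y (monomial M) S)) / (4 * Fintype.card X) := by
  have h : ∀ x y, swapDiff x y F S * swapDiff x y (monomial (g ::ₘ M)) S =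
      (swapDiff x y F S * swapDiff x y (normSum g) S) * monomial M S +
        normSum g S * (swapDiff x y F S * swapDiff x y (monomial M) S) +
        swapDiff x y F S * (swapDiff x y (normSum g) S * swapDiff x y (monomial M) S) := by
    intro x y
    rw [monomial_cons, swapDiff_mul]
    ring
  simp only [carreDuChamp, h, Finset.sum_add_distrib, ← Finset.mul_sum, ← Finset.sum_mul]
  ring

theorem abs_cubic_remainder_le [Nonempty X] {f g : X → ℝ} (hf : BalancedSign f)
    (hg : BalancedSign g) {M : Multiset (X → ℝ)} (hM : ∀ h ∈ M, BalancedSign h) (S : Finset X) :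
    |(∑ x, ∑ y, swapDiff x y (normSum f) S *
          (swapDiff x y (normSum g) S * swapDiff x y (monomial M) S)) / (4 * Fintype.card X)| ≤
      2 / √(Fintype.card X) * (3 ^ Multiset.card M * envelope M S) := by
  have hE := envelope_nonneg M S
  refine abs_sum_sum_mul_div_le (fun x y => abs_swapDiff_normSum_le hf x y S)
    fun x y => ?_
  rw [abs_mul]
  exact mul_le_mul (abs_swapDiff_normSum_le hg x y S) (abs_swapDiff_monomial_le hM x y S)
    (abs_nonneg _) (by positivity)

/-- The variance `(n / m) (1 - n / m)`. -/
noncomputable def samplingVar (X : Type) [Fintype X] (n : ℕ) : ℝ :=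
  (n / Fintype.card X : ℝ) * (1 - n / Fintype.card X)

/-- The difference between the carré du champ and its Gaussian counterpart. -/
noncomputable def steinError (f : ι → X → ℝ) (n : ℕ) (c : ι) (M : Multiset ι)
    (S : Finset X) : ℝ :=
  carreDuChamp (normSum (f c)) (monomial (M.map f)) S -
    samplingVar X n * ((M.count c : ℝ) * monomial ((M.erase c).map f) S)

theorem abs_steinError_cons_le (f : ι → X → ℝ) (c c' : ι) (M : Multiset ι) (S : Finset X) :
    |steinError f S.card c (c' ::ₘ M) S| ≤
      |carreDuChamp (normSum (f c)) (normSum (f c')) S -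
          if c' = c then samplingVar X S.card else 0| * envelope (M.map f) S +
        (1 + |normSum (f c') S|) * |steinError f S.card c M S| +
        |(∑ x, ∑ y, swapDiff x y (normSum (f c)) S * (swapDiff x y (normSum (f c')) S *
          swapDiff x y (monomial (M.map f)) S)) / (4 * Fintype.card X)| := by
  set R := (∑ x, ∑ y, swapDiff x y (normSum (f c)) S * (swapDiff x y (normSum (f c')) S *
          swapDiff x y (monomial (M.map f)) S)) / (4 * Fintype.card X)
  have h : steinError f S.card c (c' ::ₘ M) S =
      (carreDuChamp (normSum (f c)) (normSum (f c')) S -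
          if c' = c then samplingVar X S.card else 0) * monomial (M.map f) S +
        normSum (f c') S * steinError f S.card c M S + R := by
    rw [steinError, count_mul_monomial_erase_cons, Multiset.map_cons, carreDuChamp_cons,
      steinError]
    split_ifs <;> ring
  rw [h]
  refine (abs_add_le _ _).trans (add_le_add_left ((abs_add_le _ _).trans ?_) _)
  rw [abs_mul, abs_mul]
  gcongr
  · exact abs_monomial_le _ S
  · linarith

/-- Peeling off a factor `c'` leaves a smaller Stein error multiplied by `1 + |normSum (f c') S|`.
The envelope of `T` absorbs such weights, so `t` must remain free in the induction on `r`. -/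
theorem samplingMean_envelope_mul_steinError_le (r : ℕ) : ∀ t : ℕ, ∃ C : ℝ, 0 ≤ C ∧
    ∀ (X : Type) [Fintype X] [DecidableEq X] [Nonempty X] (ι : Type) [DecidableEq ι] (n : ℕ)
      (f : ι → X → ℝ) (c : ι) (M : Multiset ι) (T : Multiset (X → ℝ)),
      BalancedSign (f c) → (∀ i ∈ M, BalancedSign (f i)) →
      (∀ i ∈ M, i ≠ c → ∑ x, f c x * f i x = 0) → (∀ g ∈ T, BalancedSign g) →
      Multiset.card M = r → Multiset.card T = t →
      samplingMean n (fun S => envelope T S * |steinError f n c M S|) ≤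
        C / √(Fintype.card X) := by
  induction r with
  | zero =>
    intro t
    refine ⟨0, le_rfl, fun X _ _ _ ι _ n f c M T _ _ _ _ hr _ => ?_⟩
    rw [Multiset.card_eq_zero.1 hr]
    simpa [steinError, carreDuChamp, swapDiff] using samplingMean_const_le (X := X) n le_rfl
  | succ r ih =>
    intro t
    obtain ⟨C₁, hC₁, h₁⟩ := ih (t + 1)
    obtain ⟨C₂, hC₂, h₂⟩ := samplingMean_envelope_le (r + t + 1)
    obtain ⟨C₃, hC₃, h₃⟩ := samplingMean_envelope_le (r + t + 2)
    obtain ⟨C₄, hC₄, h₄⟩ := samplingMean_envelope_le (r + t)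
    refine ⟨C₂ + C₃ + C₁ + 2 * 3 ^ r * C₄, by positivity,
      fun X _ _ _ ι _ n f c M' T hc hM' horth hT hr ht => ?_⟩
    obtain ⟨c', hmem⟩ := Multiset.card_pos_iff_exists_mem.1 (r.succ_pos.trans_eq hr.symm)
    obtain ⟨M, rfl⟩ := Multiset.exists_cons_of_mem hmem
    have hr' : Multiset.card M = r := by simpa using hr
    have hc' := hM' c' (Multiset.mem_cons_self c' M)
    have hM : ∀ i ∈ M, BalancedSign (f i) := fun i hi => hM' i (Multiset.mem_cons_of_mem hi)
    have hMf : ∀ g ∈ M.map f, BalancedSign g := by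
      intro g hg
      obtain ⟨i, hi, rfl⟩ := Multiset.mem_map.1 hg
      exact hM i hi
    have hMT : ∀ g ∈ M.map f + T, BalancedSign g := fun g hg =>
      (Multiset.mem_add.1 hg).elim (hMf g) (hT g)
    have hcard : Multiset.card (M.map f + T) = r + t := by simp [hr', ht]
    -- One bound covers both cases: `g` is the product `f c * f c'` when the indices differ and a
    -- harmless filler when they agree.
    obtain ⟨g, hg, hΓ⟩ : ∃ g : X → ℝ, BalancedSign g ∧ ∀ S : Finset X,
        |carreDuChamp (normSum (f c)) (normSum (f c')) S -
          if c' = c then samplingVar X S.card else 0| ≤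
        ((1 + |normSum g S|) + (1 + |normSum (f c) S|) * (1 + |normSum (f c') S|)) /
          √(Fintype.card X) := by
      by_cases h : c' = c
      · subst h
        refine ⟨f c', hc', fun S => ?_⟩
        rw [if_pos rfl]
        refine (carreDuChamp_normSum_self hc S).trans ?_
        gcongr
        nlinarith [abs_nonneg (normSum (f c') S)]
      · have ho := horth c' (Multiset.mem_cons_self c' M) h
        refine ⟨_, hc.mul hc' ho, fun S => ?_⟩
        rw [if_neg h, sub_zero]
        refine (carreDuChamp_normSum_of_orthogonal hc hc' ho S).trans ?_
        gcongr
        · linarith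
        · linarith
        · linarith
    calc _ ≤ samplingMean n (fun S =>
          1 / √(Fintype.card X) * envelope (g ::ₘ (M.map f + T)) S +
          1 / √(Fintype.card X) * envelope (f c ::ₘ f c' ::ₘ (M.map f + T)) S +
          envelope (f c' ::ₘ T) S * |steinError f n c M S| +
          (2 * 3 ^ r / √(Fintype.card X)) * envelope (M.map f + T) S) :=
          samplingMean_mono fun S hS => by
            subst hS
            have hR := abs_cubic_remainder_le hc hc' hMf S
            have hE := envelope_nonneg T S
            have hE' := envelope_nonneg (M.map f) S
            calc _ ≤ envelope T S * (((1 + |normSum g S|) +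
                  (1 + |normSum (f c) S|) * (1 + |normSum (f c') S|)) / √(Fintype.card X) *
                    envelope (M.map f) S +
                  (1 + |normSum (f c') S|) * |steinError f S.card c M S| +
                  2 / √(Fintype.card X) *
                    (3 ^ Multiset.card (M.map f) * envelope (M.map f) S)) := by
                  refine mul_le_mul_of_nonneg_left
                    ((abs_steinError_cons_le f c c' M S).trans ?_) hE
                  gcongr
                  exact hΓ S
              _ = _ := by
                  simp only [envelope_cons, envelope_add, Multiset.card_map, hr']
                  ring
      _ ≤ 1 / √(Fintype.card X) * C₂ + 1 / √(Fintype.card X) * C₃ +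
            C₁ / √(Fintype.card X) + (2 * 3 ^ r / √(Fintype.card X)) * C₄ := by
          simp only [samplingMean_add, samplingMean_const_mul]
          gcongr
          · exact h₂ X n _ (Multiset.forall_mem_cons.2 ⟨hg, hMT⟩) (by rw [Multiset.card_cons, hcard])
          · exact h₃ X n _ (Multiset.forall_mem_cons.2 ⟨hc, Multiset.forall_mem_cons.2 ⟨hc', hMT⟩⟩)
              (by rw [Multiset.card_cons, Multiset.card_cons, hcard])
          · exact h₁ X ι n f c M _ hc hM (fun i hi => horth i (Multiset.mem_cons_of_mem hi))
              (Multiset.forall_mem_cons.2 ⟨hc', hT⟩) hr' (by rw [Multiset.card_cons, ht])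
          · exact h₄ X n _ hMT hcard
      _ = _ := by ring

/-- Comparison of mixed moments of normalized sums under sampling without replacement with the
moments of independent variables, given by their recursion. -/
theorem abs_samplingMean_monomial_sub_le (r : ℕ) : ∃ C : ℝ, 0 ≤ C ∧
    ∀ (X : Type) [Fintype X] [DecidableEq X] [Nonempty X] (ι : Type) [Fintype ι] [DecidableEq ι]
      (n : ℕ) (f : ι → X → ℝ) (M : Multiset ι) (γ : ℕ → ℝ),
      n ≤ Fintype.card X → (∀ i ∈ M, BalancedSign (f i)) →
      (∀ i ∈ M, ∀ j ∈ M, i ≠ j → ∑ x, f i x * f j x = 0) →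
      γ 0 = 1 → γ 1 = 0 → (∀ p : ℕ, γ (p + 2) = (p + 1) * samplingVar X n * γ p) →
      Multiset.card M = r →
      |samplingMean n (monomial (M.map f)) - ∏ i, γ (M.count i)| ≤ C / √(Fintype.card X) := by
  induction r using Nat.strong_induction_on with
  | _ r ih =>
  rcases r with _ | r
  · refine ⟨0, le_rfl, fun X _ _ _ ι _ _ n f M γ hn _ _ h0 _ _ hr => ?_⟩
    rw [Multiset.card_eq_zero.1 hr]
    simp [samplingMean_const hn, h0]
  obtain ⟨C₁, hC₁, hstein⟩ := samplingMean_envelope_mul_steinError_le r 0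
  -- The recursion removes two copies of `c`, so the degree falls from `r + 1` to `r - 1`. For `r =
  -- 0` the truncated subtraction does no harm, since then no second copy exists.
  obtain ⟨C₂, hC₂, hrec⟩ := ih (r - 1) (by omega)
  refine ⟨C₁ + r * C₂, by positivity,
    fun X _ _ _ ι _ _ n f M' γ hn hM' horth h0 h1 h2 hr => ?_⟩
  obtain ⟨c, hmem⟩ := Multiset.card_pos_iff_exists_mem.1 (r.succ_pos.trans_eq hr.symm)
  obtain ⟨M, rfl⟩ := Multiset.exists_cons_of_mem hmem
  have hr' : Multiset.card M = r := by simpa using hr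
  have hc := hM' c (Multiset.mem_cons_self c M)
  have hM : ∀ i ∈ M, BalancedSign (f i) := fun i hi => hM' i (Multiset.mem_cons_of_mem hi)
  have hs : 0 ≤ √(Fintype.card X : ℝ) := Real.sqrt_nonneg _
  have hn1 : (n : ℝ) / Fintype.card X ≤ 1 :=
    div_le_one_of_le₀ (by exact_mod_cast hn) (Nat.cast_nonneg _)
  have hn0 : 0 ≤ (n : ℝ) / Fintype.card X := by positivity
  have hv0 : 0 ≤ samplingVar X n := mul_nonneg hn0 (by linarith)
  have hv1 : samplingVar X n ≤ 1 := by
    rw [samplingVar]; nlinarith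
  have hmean : samplingMean n (monomial ((c ::ₘ M).map f)) =
      samplingMean n (steinError f n c M) +
        samplingVar X n * (M.count c * samplingMean n (monomial ((M.erase c).map f))) := by
    rw [Multiset.map_cons, monomial_cons, samplingMean_normSum_mul n hc.sum,
      ← samplingMean_const_mul, ← samplingMean_const_mul, ← samplingMean_add]
    refine samplingMean_congr fun S _ => ?_
    rw [steinError]; ring
  have herr : |samplingMean n (steinError f n c M)| ≤ C₁ / √(Fintype.card X) := by
    refine (abs_samplingMean_le n _).trans ?_
    simpa using hstein X ι n f c M 0 hc hM
      (fun i hi hne => horth c (Multiset.mem_cons_self c M) i (Multiset.mem_cons_of_mem hi) hne.symm)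
      (by simp) hr' rfl
  -- Only the factor at `c` changes; there this is the recursion for `γ`, with `γ 1 = 0` covering
  -- the case that `c` is not in `M`.
  have hprod : ∏ i, γ ((c ::ₘ M).count i) =
      samplingVar X n * (M.count c * ∏ i, γ ((M.erase c).count i)) := by
    rw [Fintype.prod_eq_mul_prod_compl c, Fintype.prod_eq_mul_prod_compl c
      (fun i => γ ((M.erase c).count i))]
    have hrest : ∏ i ∈ {c}ᶜ, γ ((c ::ₘ M).count i) = ∏ i ∈ {c}ᶜ, γ ((M.erase c).count i) :=
      Finset.prod_congr rfl fun i hi => by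
        have hne : i ≠ c := by simpa using hi
        rw [Multiset.count_cons_of_ne hne, Multiset.count_erase_of_ne hne]
    rw [hrest, Multiset.count_cons_self, Multiset.count_erase_self]
    rcases M.count c with _ | p
    · simp [h1]
    · rw [h2, Nat.add_sub_cancel]
      push_cast
      ring
  rw [hmean, hprod, add_sub_assoc, ← mul_sub, ← mul_sub]
  refine (abs_add_le _ _).trans ?_
  rw [add_div]
  refine add_le_add herr ?_
  rw [abs_mul, abs_mul, abs_of_nonneg hv0, Nat.abs_cast]
  by_cases hcM : c ∈ M
  · have hih := hrec X ι n f (M.erase c) γ hn (fun i hi => hM i (Multiset.mem_of_mem_erase hi))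
      (fun i hi j hj => horth i (Multiset.mem_cons_of_mem (Multiset.mem_of_mem_erase hi)) j
        (Multiset.mem_cons_of_mem (Multiset.mem_of_mem_erase hj))) h0 h1 h2
      (by rw [Multiset.card_erase_of_mem hcM, hr']; rfl)
    have hcount : (M.count c : ℝ) ≤ r := by exact_mod_cast hr' ▸ M.count_le_card c
    calc _ ≤ 1 * (r * (C₂ / √(Fintype.card X))) := by gcongr
      _ = _ := by ring
  · rw [Multiset.count_eq_zero_of_notMem hcM]
    simp only [Nat.cast_zero, zero_mul, mul_zero]
    positivity

end Comparison

end SubsampledHadamard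

namespace SubsampledHadamard

/-! ### Recursion for the Gaussian moments -/

open MeasureTheory ProbabilityTheory

theorem integrable_pow_mul_exp_neg_mul_sq {b : ℝ} (hb : 0 < b) (p : ℕ) :
    Integrable fun x : ℝ => x ^ p * Real.exp (-b * x ^ 2) := by
  have h := integrable_rpow_mul_exp_neg_mul_sq hb (s := p) (by
    have : (0 : ℝ) ≤ p := p.cast_nonneg
    linarith)
  simpa [Real.rpow_natCast] using h

/-- Integration by parts with `u = x ^ (p + 1)` and `v = exp (-b x ^ 2)`, whose derivative supplies
the remaining power of `x`. -/
theorem integral_pow_add_two_mul_exp_neg_mul_sq {b : ℝ} (hb : 0 < b) (p : ℕ) :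
    ∫ x : ℝ, x ^ (p + 2) * Real.exp (-b * x ^ 2) =
      (p + 1) / (2 * b) * ∫ x : ℝ, x ^ p * Real.exp (-b * x ^ 2) := by
  have hu : ∀ x : ℝ, HasDerivAt (fun x : ℝ => x ^ (p + 1)) ((p + 1) * x ^ p) x := fun x => by
    simpa using hasDerivAt_pow (p + 1) x
  have hv : ∀ x : ℝ, HasDerivAt (fun x : ℝ => Real.exp (-b * x ^ 2))
      (Real.exp (-b * x ^ 2) * (-b * (2 * x))) x := fun x => by
    have h := ((hasDerivAt_pow 2 x).const_mul (-b)).exp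
    simpa using h
  have h := integral_mul_deriv_eq_deriv_mul_of_integrable (u := fun x : ℝ => x ^ (p + 1))
    (v := fun x : ℝ => Real.exp (-b * x ^ 2)) (fun x _ => hu x) (fun x _ => hv x) ?_ ?_ ?_
  · have e1 : (fun x : ℝ => x ^ (p + 1) * (Real.exp (-b * x ^ 2) * (-b * (2 * x)))) =
        fun x => (-(2 * b)) * (x ^ (p + 2) * Real.exp (-b * x ^ 2)) := by
      funext x; ring
    have e2 : (fun x : ℝ => ((p : ℝ) + 1) * x ^ p * Real.exp (-b * x ^ 2)) =
        fun x => ((p : ℝ) + 1) * (x ^ p * Real.exp (-b * x ^ 2)) := by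
      funext x; ring
    rw [e1, e2, integral_const_mul, integral_const_mul] at h
    rw [div_mul_eq_mul_div, eq_div_iff (by positivity)]
    linarith
  · refine ((integrable_pow_mul_exp_neg_mul_sq hb (p + 2)).const_mul (-(2 * b))).congr
      (Filter.Eventually.of_forall fun x => ?_)
    simp only [Pi.mul_apply]; ring
  · refine ((integrable_pow_mul_exp_neg_mul_sq hb p).const_mul ((p : ℝ) + 1)).congr
      (Filter.Eventually.of_forall fun x => ?_)
    simp only [Pi.mul_apply]; ring
  · exact integrable_pow_mul_exp_neg_mul_sq hb (p + 1)

theorem integral_pow_gaussianReal_add_two (v : NNReal) (p : ℕ) :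
    ∫ x, x ^ (p + 2) ∂(gaussianReal 0 v) = (p + 1) * v * ∫ x, x ^ p ∂(gaussianReal 0 v) := by
  -- At variance zero the law is a point mass without density, and both sides vanish.
  by_cases hv : v = 0
  · simp [hv, gaussianReal_zero_var]
  have hv' : (0 : ℝ) < v := by positivity
  have key : ∀ q : ℕ, ∫ x, x ^ q ∂(gaussianReal 0 v) =
      (√(2 * Real.pi * v))⁻¹ * ∫ x : ℝ, x ^ q * Real.exp (-(1 / (2 * v)) * x ^ 2) := fun q => by
    rw [integral_gaussianReal_eq_integral_smul hv, ← integral_const_mul]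
    congr 1
    funext x
    rw [gaussianPDFReal, smul_eq_mul, sub_zero,
      show -x ^ 2 / (2 * (v : ℝ)) = -(1 / (2 * v)) * x ^ 2 by ring]
    ring
  rw [key, key, integral_pow_add_two_mul_exp_neg_mul_sq (by positivity)]
  field_simp

theorem gaussianMoment_zero (κ : ℝ) : gaussianMoment κ 0 = 1 := by
  simp [gaussianMoment]

theorem gaussianMoment_one (κ : ℝ) : gaussianMoment κ 1 = 0 := by
  simp [gaussianMoment]

theorem gaussianMoment_add_two {κ : ℝ} (hκ : 0 ≤ κ * (1 - κ)) (p : ℕ) :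
    gaussianMoment κ (p + 2) = (p + 1) * (κ * (1 - κ)) * gaussianMoment κ p := by
  rw [gaussianMoment, integral_pow_gaussianReal_add_two, Real.coe_toNNReal _ hκ, gaussianMoment]

end SubsampledHadamard

namespace SubsampledHadamard

set_option linter.unusedSectionVars false

/-! ### Walsh characters and the entries of the centred matrix -/

section Walsh

/-- The Walsh function of index `c`. -/
def walsh (ℓ c x : ℕ) : ℝ :=
  ∏ r ∈ Finset.range ℓ, if c.testBit r && x.testBit r then -1 else 1

theorem walsh_comm (ℓ c x : ℕ) : walsh ℓ c x = walsh ℓ x c := by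
  simp only [walsh, Bool.and_comm]

theorem walsh_xor_left (ℓ c d x : ℕ) : walsh ℓ (c ^^^ d) x = walsh ℓ c x * walsh ℓ d x := by
  rw [walsh, walsh, walsh, ← Finset.prod_mul_distrib]
  refine Finset.prod_congr rfl fun r _ => ?_
  rw [Nat.testBit_xor]
  cases c.testBit r <;> cases d.testBit r <;> cases x.testBit r <;> simp

theorem walsh_xor_right (ℓ c x y : ℕ) : walsh ℓ c (x ^^^ y) = walsh ℓ c x * walsh ℓ c y := by
  rw [walsh_comm, walsh_xor_left, walsh_comm ℓ x, walsh_comm ℓ y]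

theorem walsh_zero_left (ℓ x : ℕ) : walsh ℓ 0 x = 1 := by
  simp [walsh]

theorem walsh_mul_self (ℓ c x : ℕ) : walsh ℓ c x * walsh ℓ c x = 1 := by
  rw [← walsh_xor_left, Nat.xor_self, walsh_zero_left]

theorem walsh_two_pow {ℓ c r : ℕ} (hr : r < ℓ) (hc : c.testBit r = true) :
    walsh ℓ c (2 ^ r) = -1 := by
  rw [walsh, Finset.prod_eq_single_of_mem r (Finset.mem_range.2 hr)]
  · simp [hc]
  · intro s _ hs
    simp [hs.symm]

theorem sum_walsh {ℓ c : ℕ} (hc : c ≠ 0) (hlt : c < 2 ^ ℓ) :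
    ∑ x : Fin (2 ^ ℓ), walsh ℓ c x = 0 := by
  obtain ⟨r, hr⟩ := Nat.exists_testBit_of_ne_zero hc
  have hrl : r < ℓ := by
    by_contra h
    rw [Nat.testBit_lt_two_pow (hlt.trans_le (Nat.pow_le_pow_right two_pos (not_lt.1 h)))] at hr
    exact Bool.false_ne_true hr
  have hpow : 2 ^ r < 2 ^ ℓ := Nat.pow_lt_pow_right one_lt_two hrl
  -- Flipping a bit of `x` at which `c` has a one reverses the sign of the character, so the sum
  -- equals its negative.
  let σ : Fin (2 ^ ℓ) → Fin (2 ^ ℓ) := fun x => ⟨x.val ^^^ 2 ^ r, Nat.xor_lt_two_pow x.2 hpow⟩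
  have hσ : Function.Involutive σ := fun x => Fin.ext (by simp [σ])
  have h : ∑ x : Fin (2 ^ ℓ), walsh ℓ c x = ∑ x : Fin (2 ^ ℓ), -walsh ℓ c x := by
    refine Fintype.sum_equiv hσ.toPerm _ _ fun x => ?_
    rw [Function.Involutive.coe_toPerm, walsh_xor_right, walsh_two_pow hrl hr]
    ring
  rw [Finset.sum_neg_distrib] at h
  linarith

theorem hadamard_apply (ℓ : ℕ) (i x : Fin (2 ^ ℓ)) :
    hadamard ℓ i x = walsh ℓ i x / √((2 : ℝ) ^ ℓ) := by
  rw [hadamard, Matrix.of_apply, bitInner, ← Finset.prod_pow_eq_pow_sum, walsh]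
  congr 1
  refine Finset.prod_congr rfl fun r _ => ?_
  cases i.val.testBit r <;> cases x.val.testBit r <;> simp

/-- The product of the Walsh functions of two indices. -/
def walshPair {ℓ : ℕ} (i j : Fin (2 ^ ℓ)) (x : Fin (2 ^ ℓ)) : ℝ :=
  walsh ℓ i x * walsh ℓ j x

theorem walshPair_comm {ℓ : ℕ} (i j : Fin (2 ^ ℓ)) : walshPair i j = walshPair j i :=
  funext fun _ => mul_comm _ _

theorem balancedSign_walshPair {ℓ : ℕ} {i j : Fin (2 ^ ℓ)} (h : i ≠ j) :
    BalancedSign (walshPair i j) where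
  sq x := by
    rw [walshPair, mul_mul_mul_comm, walsh_mul_self, walsh_mul_self, one_mul]
  sum := by
    simp only [walshPair, ← walsh_xor_left]
    refine sum_walsh ?_ (Nat.xor_lt_two_pow i.2 j.2)
    rw [Ne, Nat.xor_eq_zero_iff]
    exact fun h' => h (Fin.ext h')

/-- The product of the four characters is the character of the xor of the four indices, which is
nontrivial exactly when the two pairs do not conflict. -/
theorem sum_walshPair_mul {ℓ : ℕ} {i j i' j' : Fin (2 ^ ℓ)}
    (h : i.val ^^^ j.val ≠ i'.val ^^^ j'.val) : ∑ x, walshPair i j x * walshPair i' j' x = 0 := by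
  simp only [walshPair, ← walsh_xor_left]
  refine sum_walsh ?_ (Nat.xor_lt_two_pow (Nat.xor_lt_two_pow i.2 j.2)
    (Nat.xor_lt_two_pow i'.2 j'.2))
  rwa [Ne, Nat.xor_eq_zero_iff]

theorem sqrt_smul_Psi_apply (ℓ n : ℕ) (S : Finset (Fin (2 ^ ℓ))) (i j : Fin (2 ^ ℓ)) :
    (√((2 : ℝ) ^ ℓ) • Psi ℓ n S) i j =
      (∑ x ∈ S, walshPair i j x - kappa ℓ n * ∑ x, walshPair i j x) / √((2 : ℝ) ^ ℓ) := by
  have hd : centeredSample ℓ n S = Matrix.diagonal fun x => ind S x - kappa ℓ n := by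
    ext x y
    by_cases h : x = y
    · subst h; simp [centeredSample, sampleMatrix, ind]
    · simp [centeredSample, sampleMatrix, h]
  have hpos : 0 < √((2 : ℝ) ^ ℓ) := by positivity
  rw [← sum_ind_mul, Finset.mul_sum, ← Finset.sum_sub_distrib, Matrix.smul_apply, Psi, hd,
    Matrix.mul_apply, smul_eq_mul, Finset.mul_sum, Finset.sum_div]
  refine Finset.sum_congr rfl fun x _ => ?_
  rw [Matrix.mul_diagonal, Matrix.transpose_apply, hadamard_apply, hadamard_apply, walshPair]
  field_simp

/-- The squared character is `1`, leaving `n - κ m = 0`. This gives the vanishing for weights that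
are not disassortative. -/
theorem sqrt_smul_Psi_apply_self {ℓ n : ℕ} {S : Finset (Fin (2 ^ ℓ))} (hS : S.card = n)
    (i : Fin (2 ^ ℓ)) : (√((2 : ℝ) ^ ℓ) • Psi ℓ n S) i i = 0 := by
  have hpos : (0 : ℝ) < 2 ^ ℓ := by positivity
  rw [sqrt_smul_Psi_apply]
  simp [walshPair, walsh_mul_self, hS, kappa, hpos.ne']

theorem sqrt_smul_Psi_apply_of_ne {ℓ : ℕ} (n : ℕ) (S : Finset (Fin (2 ^ ℓ))) {i j : Fin (2 ^ ℓ)}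
    (h : i ≠ j) : (√((2 : ℝ) ^ ℓ) • Psi ℓ n S) i j = normSum (walshPair i j) S := by
  rw [sqrt_smul_Psi_apply, (balancedSign_walshPair h).sum, normSum]
  simp

end Walsh

/-! ### From edges of the weight matrix to pairs of blocks -/

section Blocks

variable {k : ℕ}

theorem block_mem (π : Part k) (s : Fin (numBlocks π)) : block π s ∈ π.parts :=
  (π.parts.equivFin.symm s).2

theorem block_injective (π : Part k) : Function.Injective (block π) := fun _ _ h =>
  π.parts.equivFin.symm.injective (Subtype.ext h)

theorem exists_block_eq_part (π : Part k) (i : Fin k) : ∃ s, block π s = π.part i :=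
  ⟨π.parts.equivFin ⟨π.part i, π.part_mem.2 (Finset.mem_univ i)⟩, by simp [block]⟩

theorem pair_eq_pair_iff_finset {α : Type*} [DecidableEq α] {a b c d : α} :
    ({a, b} : Finset α) = {c, d} ↔ a = c ∧ b = d ∨ a = d ∧ b = c := by
  rw [← Finset.coe_inj]
  push_cast
  exact Set.pair_eq_pair_iff

theorem block_pair_injective (π : Part k) {s t s' t' : Fin (numBlocks π)} (h : s < t)
    (h' : s' < t')
    (heq : ({block π s, block π t} : Finset (Finset (Fin k))) = {block π s', block π t'}) :
    (s, t) = (s', t') := by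
  rcases pair_eq_pair_iff_finset.1 heq with ⟨h₁, h₂⟩ | ⟨h₁, h₂⟩
  · rw [block_injective π h₁, block_injective π h₂]
  · rw [block_injective π h₁, block_injective π h₂] at h
    exact absurd h h'.asymm

theorem exists_block_pair_eq (π : Part k) {i j : Fin k} (h : π.part i ≠ π.part j) :
    ∃ s t, s < t ∧ ({π.part i, π.part j} : Finset (Finset (Fin k))) = {block π s, block π t} := by
  obtain ⟨s, hs⟩ := exists_block_eq_part π i
  obtain ⟨t, ht⟩ := exists_block_eq_part π j
  rw [← hs, ← ht] at h ⊢
  rcases lt_or_gt_of_ne (ne_of_apply_ne _ h) with hlt | hlt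
  · exact ⟨s, t, hlt, rfl⟩
  · exact ⟨t, s, hlt, Finset.pair_comm _ _⟩

/-- A product over the edges of a disassortative weight matrix, grouped by pairs of blocks. -/
theorem prod_pow_blockWeight {A : Type*} [CommMonoid A] {w : Matrix (Fin k) (Fin k) ℕ}
    {π : Part k} (hw : Disassortative w π) (e : Fin k → Fin k → A)
    (b : Fin (numBlocks π) × Fin (numBlocks π) → A)
    (heb : ∀ i j s t, s < t →
      ({π.part i, π.part j} : Finset (Finset (Fin k))) = {block π s, block π t} →
      e i j = b (s, t)) :
    ∏ q : Fin (numBlocks π) × Fin (numBlocks π) with q.1 < q.2,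
        b q ^ blockWeight w π q.1 q.2 =
      ∏ p : Fin k × Fin k with p.1 < p.2, e p.1 p.2 ^ w p.1 p.2 := by
  simp only [blockWeight, ← Finset.prod_pow_eq_pow_sum, ← Finset.filter_filter]
  simp only [Finset.prod_filter (fun p : Fin k × Fin k =>
    ({π.part p.1, π.part p.2} : Finset (Finset (Fin k))) = _)]
  -- With the edges outermost, an edge between two blocks meets exactly one ordered pair `s < t`,
  -- while an edge inside a block has weight zero.
  rw [Finset.prod_comm]
  refine Finset.prod_congr rfl fun p hp => ?_
  have hlt : p.1 < p.2 := (Finset.mem_filter.1 hp).2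
  by_cases h : π.part p.1 = π.part p.2
  · rw [hw p.1 p.2 hlt h]
    simp
  obtain ⟨s, t, hst, hpair⟩ := exists_block_pair_eq π h
  rw [Finset.prod_eq_single_of_mem (s, t) (by simpa using hst), if_pos hpair,
    heb _ _ s t hst hpair]
  intro q hq hne
  rw [if_neg]
  intro hq'
  exact hne (block_pair_injective π (Finset.mem_filter.1 hq).2 hst (hq'.symm.trans hpair))

theorem blockLabel_eq {ι : Type*} {π : Part k} {a : Fin k → ι} (ha : IsLabelling π a) {i : Fin k}
    {s : Fin (numBlocks π)} (h : π.part i = block π s) : a i = blockLabel π a s := by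
  rw [blockLabel, ha, h]
  exact (π.part_eq_of_mem (block_mem π s) (Finset.min'_mem _ _)).symm

theorem blockLabel_injective {ι : Type*} {π : Part k} {a : Fin k → ι} (ha : IsLabelling π a) :
    Function.Injective (blockLabel π a) := by
  intro s t h
  refine block_injective π ?_
  rw [blockLabel, blockLabel, ha] at h
  rwa [π.part_eq_of_mem (block_mem π s) (Finset.min'_mem _ _),
    π.part_eq_of_mem (block_mem π t) (Finset.min'_mem _ _)] at h

/-- The multiset of the pairs of blocks, with the block weights as multiplicities. -/
noncomputable def edgeMultiset (w : Matrix (Fin k) (Fin k) ℕ) (π : Part k) :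
    Multiset (Fin (numBlocks π) × Fin (numBlocks π)) :=
  Finsupp.toMultiset (Finsupp.equivFunOnFinite.symm fun q =>
    if q.1 < q.2 then blockWeight w π q.1 q.2 else 0)

theorem count_edgeMultiset (w : Matrix (Fin k) (Fin k) ℕ) (π : Part k)
    (q : Fin (numBlocks π) × Fin (numBlocks π)) :
    (edgeMultiset w π).count q = if q.1 < q.2 then blockWeight w π q.1 q.2 else 0 := by
  simp [edgeMultiset, Finsupp.count_toMultiset]

theorem mem_edgeMultiset {w : Matrix (Fin k) (Fin k) ℕ} {π : Part k}
    {q : Fin (numBlocks π) × Fin (numBlocks π)} :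
    q ∈ edgeMultiset w π ↔ q.1 < q.2 ∧ 1 ≤ blockWeight w π q.1 q.2 := by
  rw [← Multiset.one_le_count_iff_mem, count_edgeMultiset]
  split_ifs with h <;> simp [h]

theorem prod_map_edgeMultiset {A : Type*} [CommMonoid A] (w : Matrix (Fin k) (Fin k) ℕ)
    (π : Part k) (b : Fin (numBlocks π) × Fin (numBlocks π) → A) :
    ((edgeMultiset w π).map b).prod =
      ∏ q : Fin (numBlocks π) × Fin (numBlocks π) with q.1 < q.2,
        b q ^ blockWeight w π q.1 q.2 := by
  rw [Finset.prod_multiset_map_count, Finset.prod_filter]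
  refine (Finset.prod_subset (Finset.subset_univ _) fun q _ hq => ?_).trans
    (Finset.prod_congr rfl fun q _ => ?_)
  · rw [Multiset.count_eq_zero_of_notMem (by simpa using hq), pow_zero]
  · rw [count_edgeMultiset]
    split_ifs <;> simp

theorem card_edgeMultiset {w : Matrix (Fin k) (Fin k) ℕ} {π : Part k}
    (hw : Disassortative w π) : Multiset.card (edgeMultiset w π) = totalWeight w := by
  -- Exponentiating with base `2` lets the multiplicative regrouping `prod_pow_blockWeight` prove an
  -- identity of sums.
  refine Nat.pow_right_injective le_rfl ?_
  have h := prod_pow_blockWeight hw (fun _ _ => 2) (fun _ => 2) fun _ _ _ _ _ _ => rfl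
  rw [← prod_map_edgeMultiset, Multiset.map_const', Multiset.prod_replicate,
    Finset.prod_pow_eq_pow_sum] at h
  exact h

theorem gaussianProduct_eq (κ : ℝ) (w : Matrix (Fin k) (Fin k) ℕ) (π : Part k) :
    gaussianProduct κ w π = ∏ q, gaussianMoment κ ((edgeMultiset w π).count q) := by
  rw [gaussianProduct, Finset.prod_filter]
  refine Finset.prod_congr rfl fun q _ => ?_
  rw [count_edgeMultiset]
  split_ifs <;> simp [gaussianMoment_zero]

/-- Regrouping by block pairs is legitimate because `walshPair` is symmetric, so the orientation of
an edge is irrelevant, and distinct blocks have distinct labels, so only off-diagonal entries occur.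
-/
theorem matMoment_eq_monomial {ℓ : ℕ} {w : Matrix (Fin k) (Fin k) ℕ} {π : Part k}
    (hw : Disassortative w π) {a : Fin k → Fin (2 ^ ℓ)} (ha : IsLabelling π a) (n : ℕ)
    (S : Finset (Fin (2 ^ ℓ))) :
    matMoment (√((2 : ℝ) ^ ℓ) • Psi ℓ n S) w a =
      monomial ((edgeMultiset w π).map fun q =>
        walshPair (blockLabel π a q.1) (blockLabel π a q.2)) S := by
  rw [monomial, Multiset.map_map, prod_map_edgeMultiset, matMoment]
  refine (prod_pow_blockWeight hw
    (fun i j => (√((2 : ℝ) ^ ℓ) • Psi ℓ n S) (a i) (a j)) _ fun i j s t hst h => ?_).symm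
  have hne : blockLabel π a s ≠ blockLabel π a t := fun h => hst.ne (blockLabel_injective ha h)
  rcases pair_eq_pair_iff_finset.1 h with ⟨h₁, h₂⟩ | ⟨h₁, h₂⟩
  · rw [blockLabel_eq ha h₁, blockLabel_eq ha h₂, sqrt_smul_Psi_apply_of_ne n S hne]
    rfl
  · rw [blockLabel_eq ha h₁, blockLabel_eq ha h₂, sqrt_smul_Psi_apply_of_ne n S hne.symm,
      walshPair_comm]
    rfl

end Blocks

end SubsampledHadamard

/-! ### Rate of convergence and conclusion -/

namespace SubsampledHadamard

/-- Passage from the rate `m^{-1/2}` to the required form: `m ≥ 3 > e` makes the logarithm at least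
`1`. -/
theorem sqrt_rate_le {C m : ℝ} (hC : 0 ≤ C) (hm : 3 ≤ m) :
    C / √m ≤ (C + 1) * Real.log m ^ (1 : ℝ) / m ^ (1 / 4 : ℝ) := by
  have hlog : 1 ≤ Real.log m := by
    rw [Real.le_log_iff_exp_le (by linarith)]
    exact Real.exp_one_lt_three.le.trans hm
  have hpow : m ^ (1 / 4 : ℝ) ≤ √m := by
    rw [Real.sqrt_eq_rpow]
    exact Real.rpow_le_rpow_of_exponent_le (by linarith) (by norm_num)
  rw [Real.rpow_one]
  have : 0 < m ^ (1 / 4 : ℝ) := Real.rpow_pos_of_pos (by linarith) _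
  gcongr
  nlinarith

theorem matMoment_eq_zero {k : ℕ} {π : Part k} {w : Matrix (Fin k) (Fin k) ℕ}
    (hw : ¬ Disassortative w π) {ℓ n : ℕ} {a : Fin k → Fin (2 ^ ℓ)} (ha : IsLabelling π a)
    {S : Finset (Fin (2 ^ ℓ))} (hS : S ∈ samples ℓ n) :
    matMoment (√((2 : ℝ) ^ ℓ) • Psi ℓ n S) w a = 0 := by
  simp only [Disassortative, not_forall] at hw
  obtain ⟨i, j, hij, hpart, hne⟩ := hw
  refine Finset.prod_eq_zero (i := (i, j)) (by simpa using hij) ?_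
  rw [(ha i j).2 hpart, sqrt_smul_Psi_apply_self (Finset.mem_powersetCard.1 hS).2]
  exact zero_pow hne

end SubsampledHadamard

theorem mainTheorem6 :
    (∀ (k : ℕ) (π : SubsampledHadamard.Part k) (w : Matrix (Fin k) (Fin k) ℕ),
      ¬ SubsampledHadamard.Disassortative w π →
      ∀ (ℓ n : ℕ), 0 < n → n < 2 ^ ℓ →
      ∀ a : Fin k → Fin (2 ^ ℓ), SubsampledHadamard.IsLabelling π a →
      ∀ S ∈ SubsampledHadamard.samples ℓ n,
        SubsampledHadamard.matMoment
          (√((2 : ℝ) ^ ℓ) • SubsampledHadamard.Psi ℓ n S) w a = 0) ∧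
    (∀ N : ℕ, ∃ K₁ K₂ K₃ : ℝ, 0 < K₁ ∧ 0 < K₂ ∧ 0 < K₃ ∧
      ∀ (k : ℕ) (π : SubsampledHadamard.Part k) (w : Matrix (Fin k) (Fin k) ℕ),
        SubsampledHadamard.Disassortative w π →
        SubsampledHadamard.totalWeight w = N →
        ∀ (ℓ n : ℕ), 0 < n → n < 2 ^ ℓ → K₃ ≤ (2 : ℝ) ^ ℓ →
        ∀ a : Fin k → Fin (2 ^ ℓ), SubsampledHadamard.ConflictFree w π a →
          |SubsampledHadamard.expectation ℓ n (fun S =>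
              SubsampledHadamard.matMoment
                (√((2 : ℝ) ^ ℓ) • SubsampledHadamard.Psi ℓ n S) w a) -
            SubsampledHadamard.gaussianProduct (SubsampledHadamard.kappa ℓ n) w π| ≤
          K₁ * Real.log ((2 : ℝ) ^ ℓ) ^ K₂ / ((2 : ℝ) ^ ℓ) ^ (1 / 4 : ℝ)) := by
  open SubsampledHadamard in
  refine ⟨fun k π w hw ℓ n _ _ a ha S hS => matMoment_eq_zero hw ha hS, fun N => ?_⟩
  open SubsampledHadamard in
  obtain ⟨C, hC, hmain⟩ := abs_samplingMean_monomial_sub_le N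
  -- `C + 1` is positive even if `C = 0`. The exponent `1` serves only to be positive, as no
  -- logarithm is lost, and `3` ensures `log m ≥ 1`.
  refine ⟨C + 1, 1, 3, by positivity, one_pos, three_pos,
    fun k π w hw hN ℓ n _ hn hℓ a ha => le_trans ?_ (SubsampledHadamard.sqrt_rate_le hC hℓ)⟩
  open SubsampledHadamard in
  have hvar : samplingVar (Fin (2 ^ ℓ)) n = kappa ℓ n * (1 - kappa ℓ n) := by
    simp [samplingVar, kappa]
  have hκ1 : SubsampledHadamard.kappa ℓ n ≤ 1 :=
    div_le_one_of_le₀ (by exact_mod_cast hn.le) (by positivity)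
  have hκ0 : 0 ≤ SubsampledHadamard.kappa ℓ n := by
    unfold SubsampledHadamard.kappa; positivity
  have hκ := mul_nonneg hκ0 (sub_nonneg.2 hκ1)
  open SubsampledHadamard in
  have h := hmain (Fin (2 ^ ℓ)) (Fin (numBlocks π) × Fin (numBlocks π)) n
    (fun q => walshPair (blockLabel π a q.1) (blockLabel π a q.2)) (edgeMultiset w π)
    (gaussianMoment (kappa ℓ n)) (by simpa using hn.le)
    (fun q hq => balancedSign_walshPair fun h =>
      (mem_edgeMultiset.1 hq).1.ne (blockLabel_injective ha.1 h))
    (fun q hq q' hq' hne => sum_walshPair_mul fun h => by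
      obtain ⟨h₁, h₂⟩ := mem_edgeMultiset.1 hq
      obtain ⟨h₁', h₂'⟩ := mem_edgeMultiset.1 hq'
      exact ha.2 _ _ _ _ h₁ h₁' hne ⟨h₂, h₂', h⟩)
    (gaussianMoment_zero _) (gaussianMoment_one _)
    (fun p => by rw [hvar, gaussianMoment_add_two hκ]) (by rw [card_edgeMultiset hw, hN])
  rw [Fintype.card_fin, Nat.cast_pow, Nat.cast_ofNat,
    ← SubsampledHadamard.gaussianProduct_eq] at h
  simp only [SubsampledHadamard.matMoment_eq_monomial hw ha.1]
  exact h
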